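/- Let $A_1, A_2, B$ be real symmetric $n \times n$ matrices and let $c = (c_1,c_2) \in \mathbb{R}^2$. Consider the semidefinite program $$(P)\qquad \sup\ c_1x_1 + c_2x_2 \quad\text{s.t.}\quad x_1A_1 + x_2A_2 \preceq B$$ and its dual $$(D)\qquad \inf\ B \bullet Y \quad\text{s.t.}\quad A_i \bullet Y = c_i\ (i=1,2),\quad Y \succeq 0,$$ where $S \bullet T = \operatorname{trace}(ST)$, $S \preceq T$ means that $T - S$ is symmetric positive semidefinite, and optimal values are taken in $[-\infty,+\infty]$ (the value of (D) is $+\infty$ if (D) is infeasible). A reformulation of (P) is any problem obtained from it by finitely many (possibly zero) of the following operations, in any order: (1) replace $B$ by $B + \lambda A_j$ for some $j$ and some $\lambda \ne 0$; (2) exchange $(A_i,c_i)$ and $(A_j,c_j)$, where $i \neq j$; (3) replace $(A_i,c_i)$ by $\lambda(A_i,c_i) + \mu(A_j,c_j)$, where $i \neq j$ and $\lambda \neq 0$; (4) replace $A_1, A_2, B$ by $T^{\mathsf T}A_1T, T^{\mathsf T}A_2T, T^{\mathsf T}BT$, where $T$ is an invertible matrix. Suppose that (P) is feasible. Then $\operatorname{val}(P)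 < \operatorname{val}(D)$ if and only if (P) has a reformulation of the form $$(P_{\rm ref})\qquad \sup\ c_2'x_2 \quad\text{s.t.}\quad x_1\begin{pmatrix}\Lambda&0&0&0\\0&0&0&0\\0&0&0&0\\0&0&0&0\end{pmatrix} + x_2\begin{pmatrix}\times&\times&\times&M\\ \times&\Sigma&0&0\\ \times&0&-I_s&0\\ M^{\mathsf T}&0&0&0\end{pmatrix} \preceq \begin{pmatrix}I_p&0&0&0\\0&I_{r-p}&0&0\\0&0&0&0\\0&0&0&0\end{pmatrix},$$ where the diagonal blocks have orders $p$, $r-p$, $s$ and $n-r-s$ for some integers $0 \le p \le r$ and $s \ge 0$ with $r + s \le n$ (blocks may be empty), $\Lambda$ and $\Sigma$ are diagonal, $\Lambda$ is positive definite, $M \neq 0$, $c_2' > 0$, and the blocks marked $\times$ are arbitrary (subject to the second matrix being symmetric). -/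

import Mathlib

/-- The data of a semidefinite program with `m` variables and matrices of order `n`:
`sup ∑ cᵢ xᵢ` subject to `∑ xᵢ Aᵢ ⪯ B`, together with its dual
`inf B • Y` subject to `Aᵢ • Y = cᵢ` for all `i` and `Y ⪰ 0`. -/
structure SDP (m n : ℕ) where
  A : Fin m → Matrix (Fin n) (Fin n) ℝ
  B : Matrix (Fin n) (Fin n) ℝ
  c : Fin m → ℝ

namespace SDP

variable {m n : ℕ}

/-- All the matrices `A₁, …, Aₘ, B` are symmetric. -/
def IsSymm (P : SDP m n) : Prop :=
  (∀ i, (P.A i).IsSymm) ∧ P.B.IsSymm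

/-- The `x ∈ ℝᵐ` for which `B - ∑ xᵢ Aᵢ` is (symmetric) positive semidefinite. -/
def primalFeasible (P : SDP m n) : Set (Fin m → ℝ) :=
  {x | (P.B - ∑ i, x i • P.A i).PosSemidef}

/-- The (symmetric) positive semidefinite `Y` with `Aᵢ • Y = cᵢ` for all `i`,
where `S • T = trace (S T)`. -/
def dualFeasible (P : SDP m n) : Set (Matrix (Fin n) (Fin n) ℝ) :=
  {Y | Y.PosSemidef ∧ ∀ i, (P.A i * Y).trace = P.c i}

/-- The optimal value of the primal, in `[-∞, ∞]` (it is `-∞` if the primal is infeasible). -/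
noncomputable def primalVal (P : SDP m n) : EReal :=
  ⨆ x ∈ P.primalFeasible, ((∑ i, P.c i * x i : ℝ) : EReal)

/-- The optimal value of the dual, in `[-∞, ∞]` (it is `∞` if the dual is infeasible). -/
noncomputable def dualVal (P : SDP m n) : EReal :=
  ⨅ Y ∈ P.dualFeasible, (((P.B * Y).trace : ℝ) : EReal)

/-- One reformulation operation. -/
inductive ReformStep : SDP m n → SDP m n → Prop
  /-- Replace `B` by `B + a Aⱼ`, where `a ≠ 0`. -/
  | slack (P : SDP m n) (j : Fin m) (a : ℝ) (ha : a ≠ 0) :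
      ReformStep P { P with B := P.B + a • P.A j }
  /-- Exchange `(Aᵢ, cᵢ)` and `(Aⱼ, cⱼ)`, where `i ≠ j`. -/
  | exchange (P : SDP m n) (i j : Fin m) (hij : i ≠ j) :
      ReformStep P { P with
        A := fun k => P.A (Equiv.swap i j k)
        c := fun k => P.c (Equiv.swap i j k) }
  /-- Replace `(Aᵢ, cᵢ)` by `a (Aᵢ, cᵢ) + b (Aⱼ, cⱼ)`, where `i ≠ j` and `a ≠ 0`. -/
  | combine (P : SDP m n) (i j : Fin m) (hij : i ≠ j) (a b : ℝ) (ha : a ≠ 0) :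
      ReformStep P { P with
        A := Function.update P.A i (a • P.A i + b • P.A j)
        c := Function.update P.c i (a * P.c i + b * P.c j) }
  /-- Replace all `Aᵢ` by `Tᵀ Aᵢ T` and `B` by `Tᵀ B T`, where `T` is invertible. -/
  | rotate (P : SDP m n) (T : Matrix (Fin n) (Fin n) ℝ) (hT : IsUnit T) :
      ReformStep P { P with
        A := fun i => T.transpose * P.A i * T
        B := T.transpose * P.B * T }

/-- `Q` is a reformulation of `P`: it is obtained from `P` by finitely many (possibly zero)
reformulation operations, in any order. -/
def IsReformulation (P Q : SDP m n) : Prop :=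
  Relation.ReflTransGen ReformStep P Q

/-- The order-preserving identification of four consecutive blocks of indices, of lengths
`p`, `q`, `s`, `t`, with the indices `0, …, n - 1`, where `n = (p + q) + (s + t)`. -/
def blockEquiv {p q s t : ℕ} (h : (p + q) + (s + t) = n) :
    (Fin p ⊕ Fin q) ⊕ (Fin s ⊕ Fin t) ≃ Fin n :=
  ((Equiv.sumCongr finSumFinEquiv finSumFinEquiv).trans finSumFinEquiv).trans (finCongr h)

/-- The standard form of a two-variable SDP: the objective is `sup c₂ x₂` with `c₂ > 0`, and,
with respect to consecutive blocks of orders `p`, `q` (which is `r - p`), `s`, `t`,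
```
      Λ 0 0 0          X   Y   Z   M          I 0 0 0
A₁ =  0 0 0 0    A₂ =  Yᵀ  Σ   0   0     B =  0 I 0 0
      0 0 0 0          Zᵀ  0  -I   0          0 0 0 0
      0 0 0 0          Mᵀ  0   0   0          0 0 0 0
```
where `Λ = diag l` is positive definite, `Σ = diag d`, `M ≠ 0`, and `X` (symmetric), `Y`, `Z` are
arbitrary. -/
def IsStandardForm (Q : SDP 2 n) : Prop :=
  ∃ (p q s t : ℕ) (h : (p + q) + (s + t) = n)
    (l : Fin p → ℝ) (d : Fin q → ℝ) (M : Matrix (Fin p) (Fin t) ℝ)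
    (X : Matrix (Fin p) (Fin p) ℝ) (Y : Matrix (Fin p) (Fin q) ℝ) (Z : Matrix (Fin p) (Fin s) ℝ),
    (∀ i, 0 < l i) ∧ M ≠ 0 ∧ X.IsSymm ∧
    Q.c 0 = 0 ∧ 0 < Q.c 1 ∧
    Q.A 0 = Matrix.reindex (blockEquiv h) (blockEquiv h)
      (Matrix.fromBlocks
        (Matrix.fromBlocks (Matrix.diagonal l) 0 0 0) 0
        0 0) ∧
    Q.A 1 = Matrix.reindex (blockEquiv h) (blockEquiv h)
      (Matrix.fromBlocks
        (Matrix.fromBlocks X Y Y.transpose (Matrix.diagonal d))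
        (Matrix.fromBlocks Z M 0 0)
        (Matrix.fromBlocks Z.transpose 0 M.transpose 0)
        (Matrix.fromBlocks (-1) 0 0 0)) ∧
    Q.B = Matrix.reindex (blockEquiv h) (blockEquiv h)
      (Matrix.fromBlocks 1 0 0 0)

end SDP

/-!
A gap is preserved by every reformulation operation, and every operation is reversible, so only two
things have to be shown: a problem in standard form has a gap (`SDP.IsStandardForm.hasGap`, a direct
computation), and a feasible problem with a gap can be brought to standard form
(`SDP.exists_standardForm_of_hasGap`).

For the latter let `u < w` be such that all primal values are at most `u` and all dual values at
least `w`. Shift `B` so that it is a slack matrix of maximal rank; then `0` is feasible and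
`0 ≤ u < w`. The vector `c` is not in the convex set of all `(A₁ • Y, A₂ • Y)` with `Y ⪰ 0` and
`B • Y < w`. Separating it from that set yields `x ≠ 0` with `V • Y ≤ k` for all such `Y`, where
`V = x₁ A₁ + x₂ A₂` and `k = c₁ x₁ + c₂ x₂`. Testing with rank one matrices gives `w V ⪯ k B`. If
`k > 0`, then `(w / k) x` is feasible with value `w > u`, which is absurd; so `k = 0` and `-V ⪰ 0`
(`SDP.exists_posSemidef_combination`). Now `-V` can replace `A₁`, with `c₁ = 0`; it vanishes on the
kernel of `B`, because `B - V` is a slack matrix and the rank of `B` is maximal. Also `c₂ ≠ 0`,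
since otherwise `Y = 0` closes the gap, and the sign of `A₂` is chosen so that `c₂ > 0`. Testing the dual
with rank one matrices on the kernel of `A₁` shows that `w A₂ ⪯ c₂ B` there (`SDP.gapTriple`).

These relations between `B`, `A₁` and `A₂` are collected in `Matrix.GapTriple`. They survive
congruences, and they suffice to produce the block pattern of the standard form by successive
congruences. Finally `M ≠ 0`: otherwise, for any positive `x₂ < w / c₂`, the point `(x₁, x₂)` is
feasible once `x₁` is sufficiently negative (`Matrix.GapTriple.exists_posSemidef_of_eq_zero`), and
some of these points have value above `u`.
-/

open Matrix

/-! ### Separation and scaling -/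

/-- In finite dimension a point outside a nonempty convex set `K`, with no openness or closedness
assumed, is separated from it by a nonzero functional. If `K` has empty interior, it lies in a
hyperplane, and a functional constant on that hyperplane will do, up to sign. -/
theorem Convex.exists_ne_zero_forall_le {E : Type*} [NormedAddCommGroup E] [NormedSpace ℝ E]
    [FiniteDimensional ℝ E] {K : Set E} (hK : Convex ℝ K) (hne : K.Nonempty) {c : E}
    (hc : c ∉ K) : ∃ f : E →ₗ[ℝ] ℝ, f ≠ 0 ∧ ∀ y ∈ K, f y ≤ f c := by
  by_cases hint : (interior K).Nonempty
  · obtain ⟨f, hf, hle⟩ := geometric_hahn_banach_of_nonempty_interior_point hK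
      (fun h => hc (interior_subset h)) hint
    exact ⟨f.toLinearMap, fun h => hf (ContinuousLinearMap.coe_injective h), hle⟩
  · rw [hK.interior_nonempty_iff_affineSpan_eq_top] at hint
    obtain ⟨y₀, hy₀⟩ := hne
    have hdir : vectorSpan ℝ K < ⊤ := by
      rw [lt_top_iff_ne_top]
      intro h
      exact hint ((AffineSubspace.affineSpan_eq_top_iff_vectorSpan_eq_top_of_nonempty ℝ E E
        ⟨y₀, hy₀⟩).2 h)
    obtain ⟨f, hf, hker⟩ := Submodule.exists_le_ker_of_lt_top _ hdir
    have hconst : ∀ y ∈ K, f y = f y₀ := fun y hy => by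
      have := hker (vsub_mem_vectorSpan ℝ hy hy₀)
      rw [LinearMap.mem_ker, vsub_eq_sub, map_sub] at this
      linarith
    rcases le_total (f y₀) (f c) with h | h
    · exact ⟨f, hf, fun y hy => (hconst y hy).trans_le h⟩
    · refine ⟨-f, neg_ne_zero.2 hf, fun y hy => ?_⟩
      simpa [hconst y hy] using h

/-- If `q` and `v` are the values at a vector of two quadratic forms, then a bound on the second
form along all multiples of the vector on which the first is less than `w` is an inequality
between the two forms themselves. -/
theorem mul_le_mul_of_forall_scaling {q v k w : ℝ} (hq : 0 ≤ q) (hw : 0 < w)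
    (h : ∀ t : ℝ, t * t * q < w → t * t * v ≤ k) : w * v ≤ k * q := by
  have hk : 0 ≤ k := by simpa using h 0 (by simpa using hw)
  by_contra! hlt
  have hv : 0 < v := by
    by_contra! hv
    nlinarith [mul_nonneg hk hq, mul_nonneg hw.le (neg_nonneg.2 hv)]
  obtain ⟨τ, h0, h1, h2⟩ : ∃ τ : ℝ, 0 ≤ τ ∧ τ * q < w ∧ k < τ * v := by
    rcases hq.eq_or_lt with rfl | hq
    · exact ⟨(k + 1) / v, by positivity, by simpa using hw, by field_simp; linarith⟩
    · obtain ⟨τ, h1, h2⟩ := exists_between (show k / v < w / q by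
        rw [div_lt_div_iff₀ hv hq]; exact hlt)
      exact ⟨τ, (by positivity : 0 ≤ k / v).trans h1.le, (lt_div_iff₀ hq).1 h2,
        (div_lt_iff₀ hv).1 h1⟩
  have := h (Real.sqrt τ)
  rw [Real.mul_self_sqrt h0] at this
  exact absurd (this h1) (not_le.2 h2)

theorem Matrix.trace_mul_vecMulVec_self {ι : Type*} [Fintype ι] (S : Matrix ι ι ℝ) (z : ι → ℝ) :
    (S * vecMulVec z z).trace = z ⬝ᵥ S *ᵥ z := by
  rw [mul_vecMulVec, trace_vecMulVec, dotProduct_comm]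

/-! ### Duality gaps and reformulations -/

namespace SDP

variable {m n : ℕ}

/-- There is a positive duality gap, expressed by two reals: `u` bounds the primal values from
above, `w` bounds the dual values from below, and `u < w`. Infeasibility of the dual is covered,
since the bound on its values is then vacuous. -/
def HasGap (P : SDP m n) : Prop :=
  ∃ u w : ℝ, u < w ∧ (∀ x ∈ P.primalFeasible, ∑ i, P.c i * x i ≤ u) ∧
    ∀ Y ∈ P.dualFeasible, w ≤ (P.B * Y).trace

theorem primalVal_lt_dualVal_iff (P : SDP m n) : P.primalVal < P.dualVal ↔ P.HasGap := by
  constructor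
  · intro h
    obtain ⟨u, hu, hlt⟩ := EReal.lt_iff_exists_real_btwn.1 h
    obtain ⟨w, huw, hw⟩ := EReal.lt_iff_exists_real_btwn.1 hlt
    refine ⟨u, w, by exact_mod_cast huw, fun x hx => ?_, fun Y hY => ?_⟩
    · exact_mod_cast (le_iSup₂ (f := fun x (_ : x ∈ P.primalFeasible) =>
        ((∑ i, P.c i * x i : ℝ) : EReal)) x hx).trans hu.le
    · exact_mod_cast hw.le.trans (iInf₂_le (f := fun Y (_ : Y ∈ P.dualFeasible) =>
        (((P.B * Y).trace : ℝ) : EReal)) Y hY)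
  · rintro ⟨u, w, huw, hP, hD⟩
    refine lt_of_le_of_lt (b := (u : EReal)) (iSup₂_le fun x hx => ?_)
      (lt_of_lt_of_le (b := (w : EReal)) (by exact_mod_cast huw) (le_iInf₂ fun Y hY => ?_))
    · exact_mod_cast hP x hx
    · exact_mod_cast hD Y hY

/-- Every operation is undone by an operation of the same kind. -/
theorem ReformStep.symm {P Q : SDP m n} (h : ReformStep P Q) : ReformStep Q P := by
  cases h with
  | slack j a ha =>
    have := ReformStep.slack { P with B := P.B + a • P.A j } j (-a) (neg_ne_zero.2 ha)
    simpa using this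
  | exchange i j hij =>
    have := ReformStep.exchange { P with
        A := fun k => P.A (Equiv.swap i j k)
        c := fun k => P.c (Equiv.swap i j k) } i j hij
    simpa using this
  | combine i j hij a b ha =>
    have := ReformStep.combine { P with
        A := Function.update P.A i (a • P.A i + b • P.A j)
        c := Function.update P.c i (a * P.c i + b * P.c j) } i j hij a⁻¹ (-(a⁻¹ * b))
        (inv_ne_zero ha)
    have h1 : a⁻¹ * (a * P.c i + b * P.c j) + -(a⁻¹ * b) * P.c j = P.c i := by
      field_simp; ring
    have h2 : a⁻¹ • (a • P.A i + b • P.A j) + (-(a⁻¹ * b)) • P.A j = P.A i := by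
      rw [smul_add, smul_smul, smul_smul, inv_mul_cancel₀ ha, one_smul, neg_smul,
        add_neg_cancel_right]
    simp only [Function.update_self, Function.update_of_ne hij.symm, h1, h2,
      Function.update_idem, Function.update_eq_self] at this
    exact this
  | rotate T hT =>
    have := ReformStep.rotate { P with
        A := fun i => T.transpose * P.A i * T
        B := T.transpose * P.B * T } T⁻¹ ((isUnit_nonsing_inv_iff).2 hT)
    have hd : IsUnit T.det := (isUnit_iff_isUnit_det T).1 hT
    have hdt : IsUnit Tᵀ.det := by rwa [det_transpose]
    have key : ∀ S : Matrix (Fin n) (Fin n) ℝ, T⁻¹ᵀ * (Tᵀ * S * T) * T⁻¹ = S := fun S => by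
      rw [transpose_nonsing_inv, Matrix.mul_assoc, Matrix.mul_assoc, Matrix.mul_assoc,
        mul_nonsing_inv T hd, Matrix.mul_one, nonsing_inv_mul_cancel_left _ _ hdt]
    simpa [key] using this

theorem IsReformulation.symm {P Q : SDP m n} (h : P.IsReformulation Q) : Q.IsReformulation P :=
  (@Relation.ReflTransGen.stdSymm _ _ ⟨fun _ _ => ReformStep.symm⟩).symm _ _ h

theorem ReformStep.isSymm {P Q : SDP m n} (h : ReformStep P Q) (hP : P.IsSymm) : Q.IsSymm := by
  cases h with
  | slack j a ha => exact ⟨hP.1, hP.2.add ((hP.1 j).smul a)⟩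
  | exchange i j hij => exact ⟨fun k => hP.1 _, hP.2⟩
  | combine i j hij a b ha =>
    refine ⟨fun k => ?_, hP.2⟩
    rcases eq_or_ne k i with rfl | hk
    · simpa using ((hP.1 k).smul a).add ((hP.1 j).smul b)
    · simpa [hk] using hP.1 k
  | rotate T hT =>
    have key : ∀ S : Matrix (Fin n) (Fin n) ℝ, S.IsSymm → (Tᵀ * S * T).IsSymm := fun S hS => by
      rw [Matrix.IsSymm, transpose_mul, transpose_mul, transpose_transpose, hS.eq, Matrix.mul_assoc]
    exact ⟨fun i => key _ (hP.1 i), key _ hP.2⟩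

/-- Each operation changes the primal and the dual values by a common constant, through
a correspondence of feasible points. -/
theorem ReformStep.hasGap {P Q : SDP m n} (h : ReformStep P Q) (hP : P.HasGap) : Q.HasGap := by
  obtain ⟨u, w, huw, hpr, hdu⟩ := hP
  cases h with
  | slack j a ha =>
    refine ⟨u + a * P.c j, w + a * P.c j, by linarith, fun x hx => ?_, fun Y hY => ?_⟩
    · have := hpr (x - Pi.single j a) (by
        simp only [primalFeasible, Set.mem_ofPred_eq] at hx ⊢
        convert hx using 1
        simp [sub_smul, Finset.sum_sub_distrib, Pi.single_apply, ite_smul]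
        abel)
      simp [mul_sub, Finset.sum_sub_distrib, Pi.single_apply] at this
      change ∑ i, P.c i * x i ≤ _
      linarith
    · have := hdu Y hY
      have h2 := hY.2 j
      change w + _ ≤ ((P.B + a • P.A j) * Y).trace
      change (P.A j * Y).trace = P.c j at h2
      rw [Matrix.add_mul, trace_add, Matrix.smul_mul, trace_smul, h2, smul_eq_mul]
      linarith
  | exchange i j hij =>
    refine ⟨u, w, huw, fun x hx => ?_, fun Y hY => hdu Y ⟨hY.1, fun k => ?_⟩⟩
    · have := hpr (fun k => x (Equiv.swap i j k)) (by
        simp only [primalFeasible, Set.mem_ofPred_eq] at hx ⊢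
        convert hx using 2
        exact Fintype.sum_equiv (Equiv.swap i j) _ _ (by simp))
      refine le_trans (le_of_eq ?_) this
      exact Fintype.sum_equiv (Equiv.swap i j) _ _ (by simp)
    · simpa using hY.2 (Equiv.swap i j k)
  | combine i j hij a b ha =>
    refine ⟨u, w, huw, fun x hx => ?_, fun Y hY => hdu Y ⟨hY.1, fun k => ?_⟩⟩
    · -- The point of the old problem corresponding to `x` has `a xᵢ` at `i` and `xⱼ + b xᵢ` at `j`.
      have key : ∀ (E : Type) [AddCommGroup E] [Module ℝ E] (g : Fin m → E),
          ∑ k, (x + (x i) • (Pi.single i (a - 1) + Pi.single j b) : Fin m → ℝ) k • g k =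
            ∑ k, x k • Function.update g i (a • g i + b • g j) k := by
        intro E _ _ g
        have : ∀ k, x k • Function.update g i (a • g i + b • g j) k =
            x k • g k + (if k = i then x i • ((a - 1) • g i + b • g j) else 0) := by
          intro k
          rcases eq_or_ne k i with rfl | hk
          · simp only [Function.update_self, if_true, ← smul_add]
            rw [sub_smul, one_smul]; congr 1; abel
          · simp [hk]
        simp only [this, Finset.sum_add_distrib]
        simp [add_smul, smul_add, Finset.sum_add_distrib, Pi.single_apply, ite_smul,
          smul_smul]
      have := hpr (x + (x i) • (Pi.single i (a - 1) + Pi.single j b)) (by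
        simp only [primalFeasible, Set.mem_ofPred_eq] at hx ⊢
        rw [key _ P.A]
        exact hx)
      have h2 := key ℝ P.c
      simp only [smul_eq_mul, mul_comm _ (P.c _)] at h2
      refine le_trans (le_of_eq ?_) (h2 ▸ this)
      simp [mul_comm]
    · rcases eq_or_ne k i with rfl | hk
      · have h1 := hY.2 k
        have h2 := hY.2 j
        simp [Function.update_of_ne hij.symm, Matrix.add_mul] at h1 h2
        rw [h2] at h1
        exact mul_left_cancel₀ ha (by linarith)
      · simpa [hk] using hY.2 k
  | rotate T hT =>
    have hd : IsUnit T.det := (isUnit_iff_isUnit_det T).1 hT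
    have htr : ∀ S Y : Matrix (Fin n) (Fin n) ℝ,
        (S * (T * Y * Tᵀ)).trace = (Tᵀ * S * T * Y).trace := fun S Y => by
      rw [← Matrix.mul_assoc, trace_mul_comm]; simp only [Matrix.mul_assoc]
    refine ⟨u, w, huw, fun x hx => hpr x ?_, fun Y hY => ?_⟩
    · simp only [primalFeasible, Set.mem_ofPred_eq] at hx ⊢
      rw [← Matrix.IsUnit.posSemidef_star_left_conjugate_iff hT]
      convert hx using 1
      simp [Matrix.mul_sub, Matrix.sub_mul, Finset.mul_sum, Finset.sum_mul, star_eq_conjTranspose]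
    · have := hdu (T * Y * Tᵀ) ⟨by simpa using hY.1.mul_mul_conjTranspose_same T, fun i => by
        rw [htr]; exact hY.2 i⟩
      rwa [htr] at this

theorem IsReformulation.hasGap {P Q : SDP m n} (h : P.IsReformulation Q) (hP : P.HasGap) :
    Q.HasGap := by
  induction h with
  | refl => exact hP
  | tail _ h ih => exact h.hasGap ih

theorem IsReformulation.isSymm {P Q : SDP m n} (h : P.IsReformulation Q) (hP : P.IsSymm) :
    Q.IsSymm := by
  induction h with
  | refl => exact hP
  | tail _ h ih => exact h.isSymm ih

end SDP

/-! ### Diagonalization of symmetric and semidefinite matrices -/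

namespace Matrix

variable {ι : Type*} [Fintype ι] [DecidableEq ι]

theorem IsSymm.exists_posSemidef_add_smul_diagonal {C : Matrix ι ι ℝ} (hC : C.IsSymm)
    {l : ι → ℝ} (hl : ∀ i, 0 < l i) : ∃ a : ℝ, (C + a • diagonal l).PosSemidef := by
  -- `zᵀ C z ≥ -K ‖z‖²`, while `(∑ 1 / lᵢ) zᵀ diag(l) z ≥ ‖z‖²`.
  set K := ∑ i, ∑ j, |C i j| with hK
  have hK0 : 0 ≤ K := Finset.sum_nonneg fun i _ => Finset.sum_nonneg fun j _ => abs_nonneg _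
  refine ⟨K * ∑ i, (l i)⁻¹, .of_dotProduct_mulVec_nonneg ?_ fun z => ?_⟩
  · rw [IsHermitian, conjTranspose_eq_transpose_of_trivial]
    exact hC.add ((isSymm_diagonal l).smul _)
  · set N := ∑ i, z i ^ 2 with hN
    have hzN : ∀ i, z i ^ 2 ≤ N := fun i =>
      Finset.single_le_sum (f := fun i => z i ^ 2) (fun _ _ => sq_nonneg _) (Finset.mem_univ i)
    have h1 : -(K * N) ≤ z ⬝ᵥ C *ᵥ z := by
      have : z ⬝ᵥ C *ᵥ z = ∑ i, ∑ j, C i j * (z i * z j) := by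
        simp only [dotProduct, mulVec, Finset.mul_sum]
        exact Finset.sum_congr rfl fun i _ => Finset.sum_congr rfl fun j _ => by ring
      rw [this, hK, Finset.sum_mul, ← Finset.sum_neg_distrib]
      refine Finset.sum_le_sum fun i _ => ?_
      rw [Finset.sum_mul, ← Finset.sum_neg_distrib]
      refine Finset.sum_le_sum fun j _ => ?_
      have h3 : |z i * z j| ≤ N := by
        rw [abs_le]
        constructor <;> nlinarith [hzN i, hzN j, sq_nonneg (z i + z j), sq_nonneg (z i - z j)]
      have h4 := neg_abs_le (C i j * (z i * z j))
      rw [abs_mul] at h4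
      nlinarith [abs_nonneg (C i j)]
    have h2 : K * N ≤ z ⬝ᵥ ((K * ∑ i, (l i)⁻¹) • diagonal l) *ᵥ z := by
      rw [smul_mulVec, dotProduct_smul, smul_eq_mul, mul_assoc]
      refine mul_le_mul_of_nonneg_left ?_ hK0
      simp only [dotProduct, mulVec_diagonal, hN, Finset.mul_sum]
      refine Finset.sum_le_sum fun i _ => ?_
      have h3 : (l i)⁻¹ ≤ ∑ i, (l i)⁻¹ := Finset.single_le_sum (f := fun i => (l i)⁻¹)
        (fun i _ => (inv_pos.2 (hl i)).le) (Finset.mem_univ i)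
      have h4 : 1 ≤ (∑ i, (l i)⁻¹) * l i := by
        calc 1 = (l i)⁻¹ * l i := (inv_mul_cancel₀ (hl i).ne').symm
          _ ≤ _ := mul_le_mul_of_nonneg_right h3 (hl i).le
      nlinarith [sq_nonneg (z i)]
    rw [add_mulVec, dotProduct_add, star_trivial]
    linarith

theorem PosSemidef.apply_eq_zero_of_diag_eq_zero {S : Matrix ι ι ℝ} (hS : S.PosSemidef) {i : ι}
    (hi : S i i = 0) (j : ι) : S j i = 0 := by
  have := (hS.dotProduct_mulVec_zero_iff (Pi.single i 1)).1 (by simp [hi])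
  simpa using congrFun this j

/-- The spectral theorem for real symmetric matrices, in terms of transposes. -/
theorem IsSymm.exists_orthogonal_diagonal {S : Matrix ι ι ℝ} (hS : S.IsSymm) :
    ∃ (U : Matrix ι ι ℝ) (d : ι → ℝ), Uᵀ * U = 1 ∧ U * Uᵀ = 1 ∧ Uᵀ * S * U = diagonal d := by
  have hH : S.IsHermitian := by rwa [IsHermitian, conjTranspose_eq_transpose_of_trivial]
  refine ⟨hH.eigenvectorUnitary, hH.eigenvalues, ?_, ?_, ?_⟩
  · simpa [star_eq_conjTranspose] using Unitary.coe_star_mul_self hH.eigenvectorUnitary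
  · simpa [star_eq_conjTranspose] using Unitary.coe_mul_star_self hH.eigenvectorUnitary
  · have := hH.conjStarAlgAut_star_eigenvectorUnitary
    simpa [Unitary.conjStarAlgAut_apply, star_eq_conjTranspose, Function.comp_def] using this

/-- The spectral theorem for a positive semidefinite matrix, the positive eigenvalues put first. -/
theorem PosSemidef.exists_orthogonal_fromBlocks {S : Matrix ι ι ℝ} (hS : S.PosSemidef) :
    ∃ (p q : ℕ) (U : Matrix ι (Fin p ⊕ Fin q) ℝ) (l : Fin p → ℝ), (∀ i, 0 < l i) ∧
      Uᵀ * U = 1 ∧ U * Uᵀ = 1 ∧ Uᵀ * S * U = fromBlocks (diagonal l) 0 0 0 := by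
  obtain ⟨U, d, h1, h2, h3⟩ := IsSymm.exists_orthogonal_diagonal
    (by simpa [IsHermitian, Matrix.IsSymm] using hS.1 : S.IsSymm)
  have hd : ∀ i, 0 ≤ d i := by
    have := hS.conjTranspose_mul_mul_same U
    rwa [conjTranspose_eq_transpose_of_trivial, h3, posSemidef_diagonal_iff] at this
  let e : ι ≃ Fin (Fintype.card {i // 0 < d i}) ⊕ Fin (Fintype.card {i // ¬ 0 < d i}) :=
    (Equiv.sumCompl fun i => 0 < d i).symm.trans
      (Equiv.sumCongr (Fintype.equivFin _) (Fintype.equivFin _))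
  refine ⟨_, _, U.submatrix id e.symm,
    fun i => d ((Fintype.equivFin {i // 0 < d i}).symm i),
    fun i => ((Fintype.equivFin {i // 0 < d i}).symm i).2, ?_, ?_, ?_⟩
  · rw [transpose_submatrix, ← submatrix_mul _ _ _ _ _ Function.bijective_id, h1]
    simp
  · rw [transpose_submatrix, submatrix_mul_equiv, h2]
    simp
  · have : (U.submatrix id e.symm)ᵀ * S * U.submatrix id e.symm =
        (Uᵀ * S * U).submatrix e.symm e.symm := rfl
    rw [this, h3]
    ext i j
    rcases i with i | i <;> rcases j with j | j
    · simp [e, diagonal_apply, ← Subtype.ext_iff]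
    · rw [submatrix_apply, diagonal_apply_ne _ (fun h => by simpa using e.symm.injective h)]; rfl
    · rw [submatrix_apply, diagonal_apply_ne _ (fun h => by simpa using e.symm.injective h)]; rfl
    · have : d (e.symm (Sum.inr i)) = 0 :=
        le_antisymm (not_lt.1 ((Fintype.equivFin {i // ¬ 0 < d i}).symm i).2) (hd _)
      by_cases hij : i = j
      · subst hij; simp [this]
      · simp [hij]

/-- Sylvester's law of inertia for a positive semidefinite matrix. -/
theorem PosSemidef.exists_congruence_fromBlocks {S : Matrix ι ι ℝ} (hS : S.PosSemidef) :
    ∃ (p q : ℕ) (T : Matrix ι (Fin p ⊕ Fin q) ℝ) (T' : Matrix (Fin p ⊕ Fin q) ι ℝ),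
      T * T' = 1 ∧ T' * T = 1 ∧ Tᵀ * S * T = fromBlocks 1 0 0 0 := by
  obtain ⟨p, q, U, l, hl, h1, h2, h3⟩ := hS.exists_orthogonal_fromBlocks
  have hs : ∀ i, Real.sqrt (l i) ≠ 0 := fun i => (Real.sqrt_pos.2 (hl i)).ne'
  let D : Matrix (Fin p ⊕ Fin q) (Fin p ⊕ Fin q) ℝ :=
    fromBlocks (diagonal fun i => (Real.sqrt (l i))⁻¹) 0 0 1
  let D' : Matrix (Fin p ⊕ Fin q) (Fin p ⊕ Fin q) ℝ :=
    fromBlocks (diagonal fun i => Real.sqrt (l i)) 0 0 1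
  have hD : D * D' = 1 := by simp [D, D', fromBlocks_multiply, hs]
  have hD' : D' * D = 1 := by simp [D, D', fromBlocks_multiply, hs]
  refine ⟨p, q, U * D, D' * Uᵀ, ?_, ?_, ?_⟩
  · rw [Matrix.mul_assoc, ← Matrix.mul_assoc D, hD, Matrix.one_mul, h2]
  · rw [Matrix.mul_assoc, ← Matrix.mul_assoc Uᵀ, h1, Matrix.one_mul, hD']
  · have : (U * D)ᵀ * S * (U * D) = Dᵀ * (Uᵀ * S * U) * D := by
      simp only [transpose_mul, Matrix.mul_assoc]
    rw [this, h3]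
    have h5 : ∀ i, (Real.sqrt (l i))⁻¹ * l i * (Real.sqrt (l i))⁻¹ = 1 := fun i => by
      nth_rw 2 [← Real.mul_self_sqrt (hl i).le]
      field_simp [hs i]
    simp [D, fromBlocks_multiply, fromBlocks_transpose, h5]

end Matrix

/-! ### Simultaneous congruence to the standard form -/

namespace Matrix

variable {ι κ τ : Type*} [Fintype ι] [Fintype κ] [Fintype τ]
  [DecidableEq ι] [DecidableEq κ] [DecidableEq τ]

/-- The triple `(B', V', N')` arises from `(B, V, N)` by one common congruence `S ↦ Tᵀ S T` with
`T` invertible. The index types may differ, so that block structures can be introduced on the way;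
invertibility of `T` is therefore expressed by a two-sided inverse `T'`. -/
def SimulCongr (B V N : Matrix ι ι ℝ) (B' V' N' : Matrix κ κ ℝ) : Prop :=
  ∃ (T : Matrix ι κ ℝ) (T' : Matrix κ ι ℝ), T * T' = 1 ∧ T' * T = 1 ∧
    Tᵀ * B * T = B' ∧ Tᵀ * V * T = V' ∧ Tᵀ * N * T = N'

theorem SimulCongr.trans {B V N : Matrix ι ι ℝ} {B' V' N' : Matrix κ κ ℝ}
    {B'' V'' N'' : Matrix τ τ ℝ}
    (h : SimulCongr B V N B' V' N') (h' : SimulCongr B' V' N' B'' V'' N'') :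
    SimulCongr B V N B'' V'' N'' := by
  obtain ⟨T, T', h1, h2, rfl, rfl, rfl⟩ := h
  obtain ⟨S, S', g1, g2, rfl, rfl, rfl⟩ := h'
  refine ⟨T * S, S' * T', ?_, ?_, ?_, ?_, ?_⟩
  · rw [Matrix.mul_assoc, ← Matrix.mul_assoc S, g1, Matrix.one_mul, h1]
  · rw [Matrix.mul_assoc, ← Matrix.mul_assoc T', h2, Matrix.one_mul, g2]
  all_goals simp only [transpose_mul, Matrix.mul_assoc]

omit [DecidableEq κ] in
theorem posSemidef_congruence_iff {T : Matrix ι κ ℝ} {T' : Matrix κ ι ℝ} (h : T * T' = 1)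
    (S : Matrix ι ι ℝ) : (Tᵀ * S * T).PosSemidef ↔ S.PosSemidef := by
  constructor
  · intro hS
    have := hS.conjTranspose_mul_mul_same T'
    have ht : T'ᵀ * Tᵀ = 1 := by rw [← transpose_mul, h, transpose_one]
    have e : T'ᵀ * (Tᵀ * S * T) * T' = (T'ᵀ * Tᵀ) * S * (T * T') := by
      simp only [Matrix.mul_assoc]
    rwa [conjTranspose_eq_transpose_of_trivial, e, h, ht, Matrix.one_mul, Matrix.mul_one] at this
  · intro hS
    simpa using hS.conjTranspose_mul_mul_same T

/-- The properties of a slack matrix `B`, a constraint matrix `V` and a further constraint matrix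
`N` from which the standard form follows: `B` and `V` are positive semidefinite, `N` is symmetric,
the kernel of `B` lies in that of `V`, and `w N ⪯ c B` on the kernel of `V`. -/
structure GapTriple (c w : ℝ) (B V N : Matrix ι ι ℝ) : Prop where
  posSemidef_B : B.PosSemidef
  posSemidef_V : V.PosSemidef
  isSymm_N : N.IsSymm
  ker_le : ∀ z, B *ᵥ z = 0 → V *ᵥ z = 0
  le : ∀ z, V *ᵥ z = 0 → w * (z ⬝ᵥ N *ᵥ z) ≤ c * (z ⬝ᵥ B *ᵥ z)

namespace GapTriple

variable {c w : ℝ} {B V N : Matrix ι ι ℝ}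

theorem congr {B' V' N' : Matrix κ κ ℝ}
    (h : GapTriple c w B V N) (hc : SimulCongr B V N B' V' N') : GapTriple c w B' V' N' := by
  obtain ⟨T, T', h1, h2, rfl, rfl, rfl⟩ := hc
  have ht : T'ᵀ * Tᵀ = 1 := by rw [← transpose_mul, h1, transpose_one]
  have key : ∀ (S : Matrix ι ι ℝ) z, (Tᵀ * S * T) *ᵥ z = 0 ↔ S *ᵥ (T *ᵥ z) = 0 := by
    intro S z
    rw [← mulVec_mulVec, ← mulVec_mulVec]
    refine ⟨fun h => ?_, fun h => by rw [h, mulVec_zero]⟩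
    have := congrArg (T'ᵀ *ᵥ ·) h
    simpa [mulVec_mulVec, ← Matrix.mul_assoc, ht] using this
  have quad : ∀ (S : Matrix ι ι ℝ) z,
      z ⬝ᵥ (Tᵀ * S * T) *ᵥ z = (T *ᵥ z) ⬝ᵥ S *ᵥ (T *ᵥ z) := by
    intro S z
    rw [← mulVec_mulVec, ← mulVec_mulVec, dotProduct_mulVec, vecMul_transpose]
  refine ⟨(posSemidef_congruence_iff h1 B).2 h.posSemidef_B,
    (posSemidef_congruence_iff h1 V).2 h.posSemidef_V, ?_, fun z hz => ?_, fun z hz => ?_⟩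
  · rw [Matrix.IsSymm, transpose_mul, transpose_mul, transpose_transpose, h.isSymm_N.eq,
      Matrix.mul_assoc]
  · rw [key] at hz ⊢
    exact h.ker_le _ hz
  · rw [key] at hz
    rw [quad, quad]
    exact h.le _ hz

omit [DecidableEq κ] in
/-- The inequality between `B` and `N` on the kernel of `V`, restricted to a set of coordinates on
which `V` vanishes. -/
theorem posSemidef_submatrix (h : GapTriple c w B V N) (g : κ → ι) (hg : ∀ i k, V i (g k) = 0) :
    ((c • B - w • N).submatrix g g).PosSemidef := by
  have hH : (c • B - w • N).IsHermitian := by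
    rw [IsHermitian, conjTranspose_eq_transpose_of_trivial]
    exact ((by simpa [IsHermitian, Matrix.IsSymm] using h.posSemidef_B.1 : B.IsSymm).smul c).sub
      (h.isSymm_N.smul w)
  refine .of_dotProduct_mulVec_nonneg (hH.submatrix g) fun z => ?_
  set E : Matrix ι κ ℝ := (1 : Matrix ι ι ℝ).submatrix id g
  have hE : (c • B - w • N).submatrix g g = Eᵀ * (c • B - w • N) * E := by
    ext i j; simp [E, mul_apply, one_apply]
  have hVE : V * E = 0 := by
    ext i k; simp [E, mul_apply, one_apply, hg]
  have := h.le (E *ᵥ z) (by rw [mulVec_mulVec, hVE, zero_mulVec])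
  rw [hE, star_trivial, ← mulVec_mulVec, ← mulVec_mulVec, dotProduct_mulVec, vecMul_transpose,
    sub_mulVec, dotProduct_sub, smul_mulVec, smul_mulVec, dotProduct_smul, dotProduct_smul]
  simpa using this

/-- `B` is brought to the form `diag(I, 0)`; then `V` lives on the first block by `ker_le`. -/
theorem exists_slack_eq_one (h : GapTriple c w B V N) :
    ∃ (r m : ℕ) (V₁ : Matrix (Fin r) (Fin r) ℝ) (N' : Matrix (Fin r ⊕ Fin m) (Fin r ⊕ Fin m) ℝ),
      SimulCongr B V N (fromBlocks 1 0 0 0) (fromBlocks V₁ 0 0 0) N' := by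
  obtain ⟨r, m, T, T', h1, h2, h3⟩ := h.posSemidef_B.exists_congruence_fromBlocks
  have h' := h.congr ⟨T, T', h1, h2, h3, rfl, rfl⟩
  refine ⟨r, m, (Tᵀ * V * T).toBlocks₁₁, _, T, T', h1, h2, h3, ?_, rfl⟩
  have hcol : ∀ i (j : Fin m), (Tᵀ * V * T) i (Sum.inr j) = 0 := fun i j => by
    have := h'.ker_le (Pi.single (Sum.inr j) 1) (by
      ext (k | k) <;> simp)
    simpa using congrFun this i
  have hrow : ∀ (j : Fin m) i, (Tᵀ * V * T) (Sum.inr j) i = 0 := fun j i => by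
    have := h'.posSemidef_V.1.apply (Sum.inr j) i
    rw [hcol] at this
    simpa using this.symm
  ext (i | i) (j | j)
  · rfl
  · exact hcol _ _
  · exact hrow _ _
  · exact hrow _ _

/-- An orthogonal change of basis in the first block diagonalizes `V` and keeps `B`. -/
theorem exists_diagonal {α β : Type*} [Fintype α] [Fintype β] [DecidableEq α] [DecidableEq β]
    {V₁ : Matrix α α ℝ} {N : Matrix (α ⊕ β) (α ⊕ β) ℝ}
    (h : GapTriple c w (fromBlocks 1 0 0 0) (fromBlocks V₁ 0 0 0) N) :
    ∃ (p q : ℕ) (l : Fin p → ℝ) (N' : Matrix ((Fin p ⊕ Fin q) ⊕ β) ((Fin p ⊕ Fin q) ⊕ β) ℝ),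
      (∀ i, 0 < l i) ∧ SimulCongr (fromBlocks 1 0 0 0) (fromBlocks V₁ 0 0 0) N
        (fromBlocks 1 0 0 0) (fromBlocks (fromBlocks (diagonal l) 0 0 0) 0 0 0) N' := by
  have hV : V₁.PosSemidef := h.posSemidef_V.submatrix Sum.inl
  obtain ⟨p, q, U, l, hl, h1, h2, h3⟩ := hV.exists_orthogonal_fromBlocks
  refine ⟨p, q, l, _, hl, fromBlocks U 0 0 1, fromBlocks Uᵀ 0 0 1, ?_, ?_, ?_, ?_, rfl⟩ <;>
    simp [fromBlocks_multiply, fromBlocks_transpose, h1, h2, h3]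

variable {p q : Type*} [Fintype p] [Fintype q] [DecidableEq p] [DecidableEq q] {l : p → ℝ}

/-- `B` and `V` vanish on the last block, so there `N` is negative semidefinite, and a congruence
of that block brings it to the form `diag(-I, 0)`. -/
theorem exists_corner_eq_neg_one {β : Type*} [Fintype β] [DecidableEq β]
    {N : Matrix ((p ⊕ q) ⊕ β) ((p ⊕ q) ⊕ β) ℝ} (hw : 0 < w)
    (h : GapTriple c w (fromBlocks 1 0 0 0) (fromBlocks (fromBlocks (diagonal l) 0 0 0) 0 0 0) N) :
    ∃ (s t : ℕ) (N₁ : Matrix (p ⊕ q) (p ⊕ q) ℝ) (N₂ : Matrix (p ⊕ q) (Fin s ⊕ Fin t) ℝ),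
      SimulCongr (fromBlocks 1 0 0 0) (fromBlocks (fromBlocks (diagonal l) 0 0 0) 0 0 0) N
        (fromBlocks 1 0 0 0) (fromBlocks (fromBlocks (diagonal l) 0 0 0) 0 0 0)
        (fromBlocks N₁ N₂ N₂ᵀ (fromBlocks (-1) 0 0 0)) := by
  have hN : (-N.toBlocks₂₂).PosSemidef := by
    have := (h.posSemidef_submatrix Sum.inr (by rintro (i | i) k <;> simp)).smul
      (inv_pos.2 hw).le
    convert this using 1
    ext i j
    simp [toBlocks₂₂, hw.ne']
  obtain ⟨s, t, T, T', h1, h2, h3⟩ := hN.exists_congruence_fromBlocks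
  have h4 : Tᵀ * N.toBlocks₂₂ * T = fromBlocks (-1) 0 0 0 := by
    rw [Matrix.mul_neg, Matrix.neg_mul] at h3
    rw [← neg_inj, h3, fromBlocks_neg]; simp
  have h5 : N.toBlocks₂₁ = N.toBlocks₁₂ᵀ := by
    ext i j; exact h.isSymm_N.apply _ _
  refine ⟨s, t, N.toBlocks₁₁, N.toBlocks₁₂ * T, fromBlocks 1 0 0 T, fromBlocks 1 0 0 T',
    ?_, ?_, ?_, ?_, ?_⟩
  · simp [fromBlocks_multiply, h1]
  · simp [fromBlocks_multiply, h2]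
  · simp [fromBlocks_multiply, fromBlocks_transpose]
  · simp [fromBlocks_multiply, fromBlocks_transpose]
  · conv_lhs => rw [← fromBlocks_toBlocks N]
    simp [fromBlocks_multiply, fromBlocks_transpose, h4, h5]

variable {s t : Type*} [Fintype s] [Fintype t] [DecidableEq s] [DecidableEq t]

/-- The remaining blocks of `N`: the block between `q` and `t` vanishes by semidefiniteness, the
block between `q` and `s` is eliminated with the help of `-I`, and the block of `q` is
diagonalized. None of this changes `B` or `V`. -/
theorem exists_standardForm {N₁ : Matrix (p ⊕ q) (p ⊕ q) ℝ} {N₂ : Matrix (p ⊕ q) (s ⊕ t) ℝ}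
    (hw : 0 < w)
    (h : GapTriple c w (fromBlocks 1 0 0 0) (fromBlocks (fromBlocks (diagonal l) 0 0 0) 0 0 0)
      (fromBlocks N₁ N₂ N₂ᵀ (fromBlocks (-1) 0 0 0))) :
    ∃ (d : q → ℝ) (M : Matrix p t ℝ) (X : Matrix p p ℝ) (Y : Matrix p q ℝ) (Z : Matrix p s ℝ),
      X.IsSymm ∧
      SimulCongr (fromBlocks 1 0 0 0) (fromBlocks (fromBlocks (diagonal l) 0 0 0) 0 0 0)
        (fromBlocks N₁ N₂ N₂ᵀ (fromBlocks (-1) 0 0 0))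
        (fromBlocks 1 0 0 0) (fromBlocks (fromBlocks (diagonal l) 0 0 0) 0 0 0)
        (fromBlocks (fromBlocks X Y Yᵀ (diagonal d)) (fromBlocks Z M 0 0)
          (fromBlocks Zᵀ 0 Mᵀ 0) (fromBlocks (-1) 0 0 0)) := by
  have hN₁ : N₁.IsSymm := h.isSymm_N.submatrix Sum.inl
  -- `c B - w N` is positive semidefinite on `q ⊕ t`, with zero diagonal on `t`.
  have hR : N₂.toBlocks₂₂ = 0 := by
    have := h.posSemidef_submatrix (κ := q ⊕ t)
      (Sum.elim (Sum.inl ∘ Sum.inr) (Sum.inr ∘ Sum.inr))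
      (by rintro ((i | i) | i) (k | k) <;> simp)
    ext i j
    have := this.apply_eq_zero_of_diag_eq_zero (i := Sum.inr j) (by simp) (Sum.inl i)
    simpa [toBlocks₂₂, hw.ne'] using this
  have hX : N₁.toBlocks₁₁.IsSymm := hN₁.submatrix Sum.inl
  have hS : N₁.toBlocks₂₂.IsSymm := hN₁.submatrix Sum.inr
  have hY : N₁.toBlocks₂₁ = N₁.toBlocks₁₂ᵀ := by ext i j; exact hN₁.apply _ _
  rw [← fromBlocks_toBlocks N₁, ← fromBlocks_toBlocks N₂, hR, hY]
  generalize N₁.toBlocks₁₁ = X, N₁.toBlocks₁₂ = Y, N₁.toBlocks₂₂ = S,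
    N₂.toBlocks₁₁ = Z, N₂.toBlocks₁₂ = M, N₂.toBlocks₂₁ = W at hX hS
  have hS' : (S + W * Wᵀ).IsSymm := by
    simp [Matrix.IsSymm, transpose_add, transpose_mul, hS.eq]
  obtain ⟨U, d, h1, h2, h3⟩ := hS'.exists_orthogonal_diagonal
  refine ⟨d, M, X, (Y + Z * Wᵀ) * U, Z, hX, ?_⟩
  refine SimulCongr.trans (τ := (p ⊕ q) ⊕ (s ⊕ t)) (κ := (p ⊕ q) ⊕ (s ⊕ t))
    (B' := fromBlocks 1 0 0 0) (V' := fromBlocks (fromBlocks (diagonal l) 0 0 0) 0 0 0)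
    (N' := fromBlocks (fromBlocks X (Y + Z * Wᵀ) (Y + Z * Wᵀ)ᵀ (S + W * Wᵀ)) (fromBlocks Z M 0 0)
          (fromBlocks Zᵀ 0 Mᵀ 0) (fromBlocks (-1) 0 0 0))
    ⟨fromBlocks 1 0 (fromBlocks 0 Wᵀ 0 0) 1, fromBlocks 1 0 (-fromBlocks 0 Wᵀ 0 0) 1,
      ?_, ?_, ?_, ?_, ?_⟩
    ⟨fromBlocks (fromBlocks 1 0 0 U) 0 0 1, fromBlocks (fromBlocks 1 0 0 Uᵀ) 0 0 1,
      ?_, ?_, ?_, ?_, ?_⟩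
  · simp [fromBlocks_multiply]
  · simp [fromBlocks_multiply]
  · simp [fromBlocks_multiply, fromBlocks_transpose]
  · simp [fromBlocks_multiply, fromBlocks_transpose]
  · simp [fromBlocks_multiply, fromBlocks_transpose, fromBlocks_add]
  · simp [fromBlocks_multiply, h2]
  · simp [fromBlocks_multiply, h1]
  · simp [fromBlocks_multiply, fromBlocks_transpose, h1]
  · simp [fromBlocks_multiply, fromBlocks_transpose]
  · simp [fromBlocks_multiply, fromBlocks_transpose, h3]

/-- If the block `M` of the standard form is zero, then the second variable can take any
positive value below `w / c` provided that the first one is negative enough: the slack matrix is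
positive definite on `q ⊕ s`, it is zero on `t`, and its Schur complement in `p` is positive
semidefinite as soon as `a` is large. -/
theorem exists_posSemidef_of_eq_zero (hw : 0 < w) (hl : ∀ i, 0 < l i) {d : q → ℝ}
    {X : Matrix p p ℝ} {Y : Matrix p q ℝ} {Z : Matrix p s ℝ}
    (h : GapTriple c w (fromBlocks 1 0 0 0) (fromBlocks (fromBlocks (diagonal l) 0 0 0) 0 0 0)
      (fromBlocks (fromBlocks X Y Yᵀ (diagonal d)) (fromBlocks Z 0 0 0)
          (fromBlocks Zᵀ 0 (0 : Matrix p t ℝ)ᵀ 0) (fromBlocks (-1) 0 0 0)))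
    {y : ℝ} (hy : 0 < y) (hyw : y * c < w) :
    ∃ a : ℝ, (fromBlocks 1 0 0 0 - y • (fromBlocks (fromBlocks X Y Yᵀ (diagonal d))
        (fromBlocks Z 0 0 0) (fromBlocks Zᵀ 0 (0 : Matrix p t ℝ)ᵀ 0) (fromBlocks (-1) 0 0 0)) +
      a • fromBlocks (fromBlocks (diagonal l) 0 0 0) 0 0 0).PosSemidef := by
  have hX : X.IsSymm := (h.isSymm_N.submatrix Sum.inl).submatrix Sum.inl
  have hd : ∀ i, 0 < 1 - y * d i := fun i => by
    have := (h.posSemidef_submatrix (κ := q) (Sum.inl ∘ Sum.inr)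
      (by rintro ((i | i) | i) k <;> simp)).diag_nonneg (i := i)
    have h1 : w * d i ≤ c := by simpa using this
    by_contra! h2
    nlinarith [mul_pos hy hw]
  -- The entries `1` on `t` make `diag(e)` invertible; a projection removes them at the end.
  let e : q ⊕ (s ⊕ t) → ℝ := Sum.elim (fun i => 1 - y * d i) (Sum.elim (fun _ => y) (fun _ => 1))
  have he : ∀ i, 0 < e i := by
    rintro (i | i | i)
    exacts [hd i, hy, one_pos]
  have hD : (diagonal e).PosDef := PosDef.diagonal he
  let G : Matrix p (q ⊕ (s ⊕ t)) ℝ := fromCols (-(y • Y)) (fromCols (-(y • Z)) 0)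
  obtain ⟨a, ha⟩ := IsSymm.exists_posSemidef_add_smul_diagonal
    (C := 1 - y • X - G * (diagonal e)⁻¹ * Gᵀ) (by
      refine (isSymm_one.sub (hX.smul y)).sub ?_
      rw [Matrix.IsSymm, transpose_mul, transpose_mul, transpose_transpose, transpose_nonsing_inv,
        diagonal_transpose, Matrix.mul_assoc]) hl
  refine ⟨a, ?_⟩
  let := hD.isUnit.invertible
  have hSchur : ((1 - y • X + a • diagonal l) - G * (diagonal e)⁻¹ * Gᴴ).PosSemidef := by
    rw [conjTranspose_eq_transpose_of_trivial, add_sub_right_comm]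
    exact ha
  have hM : ((fromBlocks (1 - y • X + a • diagonal l) G Gᴴ (diagonal e)).submatrix
      (Equiv.sumAssoc p q (s ⊕ t)) (Equiv.sumAssoc p q (s ⊕ t))).PosSemidef :=
    ((PosDef.fromBlocks₂₂ _ G hD).2 hSchur).submatrix _
  have hsub : (fromBlocks (1 - y • X + a • diagonal l) G Gᴴ (diagonal e)).submatrix
      (Equiv.sumAssoc p q (s ⊕ t)) (Equiv.sumAssoc p q (s ⊕ t)) =
      fromBlocks (fromBlocks (1 - y • X + a • diagonal l) (-(y • Y)) (-(y • Yᵀ))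
        (1 - y • diagonal d)) (fromBlocks (-(y • Z)) 0 0 0) (fromBlocks (-(y • Zᵀ)) 0 0 0)
        (fromBlocks (y • 1) 0 0 1) := by
    ext ((i | i) | (i | i)) ((j | j) | (j | j)) <;>
      simp [G, e, diagonal_apply, one_apply] <;> split_ifs <;> simp
  rw [hsub] at hM
  let D : Matrix ((p ⊕ q) ⊕ (s ⊕ t)) ((p ⊕ q) ⊕ (s ⊕ t)) ℝ :=
    fromBlocks 1 0 0 (fromBlocks 1 0 0 0)
  have hP := hM.conjTranspose_mul_mul_same D
  refine (congrArg PosSemidef ?_).mpr hP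
  simp only [D, conjTranspose_eq_transpose_of_trivial, fromBlocks_transpose, fromBlocks_multiply,
    fromBlocks_smul, sub_eq_add_neg, fromBlocks_neg, fromBlocks_add]
  simp only [← fromBlocks_one (l := p) (m := q), fromBlocks_add]
  simp [fromBlocks_multiply]

end GapTriple

end Matrix

/-! ### From a gap to the standard form -/

namespace SDP

variable {n : ℕ}

theorem IsReformulation.trans {P Q R : SDP 2 n} (h : P.IsReformulation Q)
    (h' : Q.IsReformulation R) : P.IsReformulation R :=
  Relation.ReflTransGen.trans h h'

/-- `(A₁, c₁)` may be replaced by any nontrivial combination of the `(Aᵢ, cᵢ)`. -/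
theorem isReformulation_smul_combination (P : SDP 2 n) {x : Fin 2 → ℝ} (hx : x ≠ 0) :
    ∃ Q : SDP 2 n, P.IsReformulation Q ∧ Q.A 0 = ∑ i, x i • P.A i ∧ Q.c 0 = ∑ i, P.c i * x i ∧
      Q.B = P.B := by
  by_cases h0 : x 0 = 0
  · have h1 : x 1 ≠ 0 := fun h1 => hx (by ext i; fin_cases i <;> assumption)
    have e1 := ReformStep.exchange P 0 1 (by decide)
    have e2 := ReformStep.combine { P with
        A := fun k => P.A (Equiv.swap 0 1 k)
        c := fun k => P.c (Equiv.swap 0 1 k) } 0 1 (by decide) (x 1) 0 h1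
    refine ⟨_, (Relation.ReflTransGen.single e1).tail e2, ?_, ?_, rfl⟩
    · simp [h0]
    · simp [h0, mul_comm (P.c 1)]
  · refine ⟨_, Relation.ReflTransGen.single (.combine P 0 1 (by decide) (x 0) (x 1) h0), ?_, ?_,
      rfl⟩
    · simp
    · simp [mul_comm]

/-- `B` may be replaced by any slack matrix. -/
theorem isReformulation_slack (P : SDP 2 n) (x : Fin 2 → ℝ) :
    P.IsReformulation { P with B := P.B - ∑ i, x i • P.A i } := by
  have key : ∀ (Q : SDP 2 n) (j : Fin 2) (a : ℝ),
      Q.IsReformulation { Q with B := Q.B + a • Q.A j } := by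
    intro Q j a
    by_cases ha : a = 0
    · subst ha
      rw [zero_smul, add_zero]
      exact .refl
    · exact .single (.slack Q j a ha)
  have := (key P 0 (-x 0)).trans (key _ 1 (-x 1))
  have e : P.B - ∑ i, x i • P.A i = P.B + -x 0 • P.A 0 + -x 1 • P.A 1 := by
    simp only [Fin.sum_univ_two, neg_smul]; abel
  rw [e]
  exact this

theorem isReformulation_rotate (P : SDP 2 n) {κ : Type*} [Fintype κ] [DecidableEq κ]
    (e : κ ≃ Fin n) {T : Matrix (Fin n) κ ℝ} {T' : Matrix κ (Fin n) ℝ} (h1 : T * T' = 1)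
    (h2 : T' * T = 1) :
    P.IsReformulation { P with
      A := fun i => reindex e e (Tᵀ * P.A i * T)
      B := reindex e e (Tᵀ * P.B * T) } := by
  have hT : IsUnit (T.submatrix id e.symm) := by
    refine ⟨⟨T.submatrix id e.symm, T'.submatrix e.symm id, ?_, ?_⟩, rfl⟩
    · rw [submatrix_mul_equiv, h1]; simp
    · rw [← submatrix_mul _ _ _ _ _ Function.bijective_id, h2]; simp
  exact .single (.rotate P _ hT)

theorem primalFeasible_slack (P : SDP 2 n) (x y : Fin 2 → ℝ) :
    y ∈ ({ P with B := P.B - ∑ i, x i • P.A i } : SDP 2 n).primalFeasible ↔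
      x + y ∈ P.primalFeasible := by
  simp only [primalFeasible, Set.mem_ofPred_eq, Pi.add_apply, add_smul, Finset.sum_add_distrib,
    sub_add_eq_sub_sub]

/-- If adding `V` does not increase the rank of `B`, then `ker (B + V) = ker B ⊓ ker V`
is all of `ker B`. -/
theorem ker_le_of_rank_le {B V : Matrix (Fin n) (Fin n) ℝ} (hB : B.PosSemidef) (hV : V.PosSemidef)
    (h : (B + V).rank ≤ B.rank) (z : Fin n → ℝ) (hz : B *ᵥ z = 0) : V *ᵥ z = 0 := by
  have hle : LinearMap.ker (B + V).mulVecLin ≤ LinearMap.ker B.mulVecLin := by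
    intro y hy
    rw [LinearMap.mem_ker, mulVecLin_apply] at hy ⊢
    have h0 : y ⬝ᵥ B *ᵥ y + y ⬝ᵥ V *ᵥ y = 0 := by
      rw [← dotProduct_add, ← add_mulVec, hy, dotProduct_zero]
    have h1 := hB.dotProduct_mulVec_nonneg y
    have h2 := hV.dotProduct_mulVec_nonneg y
    rw [← hB.dotProduct_mulVec_zero_iff]
    rw [star_trivial] at h1 h2 ⊢
    linarith
  have hdim : Module.finrank ℝ (LinearMap.ker B.mulVecLin) ≤
      Module.finrank ℝ (LinearMap.ker (B + V).mulVecLin) := by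
    have h1 := B.mulVecLin.finrank_range_add_finrank_ker
    have h2 := (B + V).mulVecLin.finrank_range_add_finrank_ker
    rw [Matrix.rank] at h
    rw [Matrix.rank] at h
    omega
  have heq := Submodule.eq_of_le_of_finrank_le hle hdim
  have hz' : z ∈ LinearMap.ker (B + V).mulVecLin := by
    rw [heq, LinearMap.mem_ker, mulVecLin_apply, hz]
  rw [LinearMap.mem_ker, mulVecLin_apply, add_mulVec, hz, zero_add] at hz'
  exact hz'

/-- Up to reformulation, `B` is itself a slack matrix of maximal rank. -/
theorem exists_maximal_slack (P : SDP 2 n) (hfeas : P.primalFeasible.Nonempty) :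
    ∃ Q : SDP 2 n, P.IsReformulation Q ∧ Q.B.PosSemidef ∧
      ∀ x ∈ Q.primalFeasible, (Q.B - ∑ i, x i • Q.A i).rank ≤ Q.B.rank := by
  let f : (Fin 2 → ℝ) → ℕ := fun x => (P.B - ∑ i, x i • P.A i).rank
  obtain ⟨x, hx, hmax⟩ : ∃ x ∈ P.primalFeasible, ∀ y ∈ P.primalFeasible, f y ≤ f x := by
    have hfin : (f '' P.primalFeasible).Finite :=
      (Set.finite_Iic n).subset (by
        rintro _ ⟨x, -, rfl⟩
        exact rank_le_height _)
    obtain ⟨_, ⟨x, hx, rfl⟩, hmax⟩ := hfin.exists_maximalFor id _ (hfeas.image f)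
    refine ⟨x, hx, fun y hy => ?_⟩
    by_contra! hlt
    exact absurd (hmax ⟨y, hy, rfl⟩ hlt.le) (not_le.2 hlt)
  refine ⟨_, P.isReformulation_slack x, hx, fun y hy => ?_⟩
  have := hmax _ ((P.primalFeasible_slack x y).1 hy)
  simpa only [f, Pi.add_apply, add_smul, Finset.sum_add_distrib, sub_add_eq_sub_sub] using this

/-- The right-hand sides `c` for which the dual has a feasible point of value less than `w`
form a convex set. -/
theorem convex_dualImage (P : SDP 2 n) (w : ℝ) :
    Convex ℝ {k : Fin 2 → ℝ | ∃ Y : Matrix (Fin n) (Fin n) ℝ, Y.PosSemidef ∧ (P.B * Y).trace < w ∧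
      ∀ i, (P.A i * Y).trace = k i} := by
  rintro k₁ ⟨Y₁, h₁, hB₁, hA₁⟩ k₂ ⟨Y₂, h₂, hB₂, hA₂⟩ a b ha hb hab
  refine ⟨a • Y₁ + b • Y₂, (h₁.smul ha).add (h₂.smul hb), ?_, fun i => ?_⟩
  · simp only [Matrix.mul_add, Matrix.mul_smul, trace_add, trace_smul, smul_eq_mul]
    rcases ha.eq_or_lt with rfl | ha
    · have : b = 1 := by linarith
      simpa [this] using hB₂
    · calc _ < a * w + b * w :=
          add_lt_add_of_lt_of_le (mul_lt_mul_of_pos_left hB₁ ha)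
            (mul_le_mul_of_nonneg_left hB₂.le hb)
        _ = w := by rw [← add_mul, hab, one_mul]
  · simp [Matrix.mul_add, hA₁, hA₂]

/-- A gap forces a nonzero direction `x` along which the objective is constant and which can be
subtracted from every feasible point. It is obtained by separating `c` from the right-hand sides
that have a dual point of value less than `w`. -/
theorem exists_posSemidef_combination (P : SDP 2 n) (hsymm : P.IsSymm) (hB : P.B.PosSemidef)
    {u w : ℝ} (huw : u < w) (hpr : ∀ x ∈ P.primalFeasible, ∑ i, P.c i * x i ≤ u)
    (hdu : ∀ Y ∈ P.dualFeasible, w ≤ (P.B * Y).trace) :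
    ∃ x : Fin 2 → ℝ, x ≠ 0 ∧ ∑ i, P.c i * x i = 0 ∧ (∑ i, x i • P.A i).PosSemidef := by
  have hu : 0 ≤ u := by simpa using hpr 0 (by simpa [primalFeasible] using hB)
  have hw : 0 < w := hu.trans_lt huw
  obtain ⟨f, hf, hle⟩ := (P.convex_dualImage w).exists_ne_zero_forall_le
    ⟨0, 0, .zero, by simpa using hw, by simp⟩ (c := P.c)
    (fun ⟨Y, hY, hBY, hAY⟩ => absurd (hdu Y ⟨hY, hAY⟩) (not_le.2 hBY))
  set x : Fin 2 → ℝ := fun i => f (Pi.single i 1) with hx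
  have hfx : ∀ k : Fin 2 → ℝ, f k = ∑ i, k i * x i := fun k => by
    rw [f.pi_apply_eq_sum_univ k]
    refine Finset.sum_congr rfl fun i _ => ?_
    rw [smul_eq_mul]; congr 3; ext j; simp [Pi.single_apply, eq_comm]
  have hx0 : x ≠ 0 := fun h => hf (LinearMap.ext fun k => by rw [hfx, h]; simp)
  set V := ∑ i, x i • P.A i with hV
  have hVs : V.IsSymm := by
    simpa [V, Fin.sum_univ_two] using ((hsymm.1 0).smul (x 0)).add ((hsymm.1 1).smul (x 1))
  set k := ∑ i, P.c i * x i with hk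
  have htr : ∀ Y : Matrix (Fin n) (Fin n) ℝ, Y.PosSemidef → (P.B * Y).trace < w →
      (V * Y).trace ≤ k := by
    intro Y hY hBY
    have := hle (fun i => (P.A i * Y).trace) ⟨Y, hY, hBY, fun _ => rfl⟩
    rw [hfx, hfx] at this
    refine le_trans (le_of_eq ?_) this
    simp only [hV, Finset.sum_mul, trace_sum, Matrix.smul_mul, trace_smul, smul_eq_mul,
      mul_comm (x _)]
  -- Rank one matrices suffice to conclude that `w V ⪯ k B`.
  have hkB : ∀ z : Fin n → ℝ, w * (z ⬝ᵥ V *ᵥ z) ≤ k * (z ⬝ᵥ P.B *ᵥ z) := by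
    intro z
    refine mul_le_mul_of_forall_scaling (by simpa using hB.dotProduct_mulVec_nonneg z) hw
      fun t ht => ?_
    have := htr (vecMulVec (t • z) (t • z))
      (by simpa using posSemidef_vecMulVec_self_star (t • z)) (by
        rw [trace_mul_vecMulVec_self]
        simpa [mulVec_smul, mul_assoc] using ht)
    rw [trace_mul_vecMulVec_self] at this
    simpa [mulVec_smul, mul_assoc] using this
  have hk0 : 0 ≤ k := by simpa using htr 0 .zero (by simpa using hw)
  -- If `k > 0`, then `(w / k) x` is feasible with value `w`, which exceeds `u`.
  have hk1 : k = 0 := by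
    by_contra hne
    have hkpos : 0 < k := lt_of_le_of_ne hk0 (Ne.symm hne)
    have hfe : (w / k) • x ∈ P.primalFeasible := by
      have hs : ∑ i, ((w / k) • x) i • P.A i = (w / k) • V := by
        simp [hV, smul_smul]
      rw [primalFeasible, Set.mem_ofPred_eq, hs]
      refine .of_dotProduct_mulVec_nonneg ?_ fun z => ?_
      · rw [IsHermitian, conjTranspose_eq_transpose_of_trivial]
        exact hsymm.2.sub (hVs.smul _)
      · rw [star_trivial, sub_mulVec, dotProduct_sub, smul_mulVec, dotProduct_smul, smul_eq_mul,
          sub_nonneg, div_mul_eq_mul_div, div_le_iff₀ hkpos, mul_comm _ k]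
        exact hkB z
    have := hpr _ hfe
    have hval : ∑ i, P.c i * ((w / k) • x) i = w := by
      have : ∑ i, P.c i * ((w / k) • x) i = (w / k) * k := by
        rw [hk, Finset.mul_sum]
        exact Finset.sum_congr rfl fun i _ => by simp; ring
      rw [this, div_mul_cancel₀ _ hne]
    linarith
  refine ⟨-x, neg_ne_zero.2 hx0, ?_, ?_⟩
  · rw [← neg_eq_zero, ← hk1, hk, ← Finset.sum_neg_distrib]; simp
  have hs : ∑ i, (-x) i • P.A i = -V := by
    simp only [hV, Pi.neg_apply, neg_smul, Finset.sum_neg_distrib]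
  rw [hs]
  refine .of_dotProduct_mulVec_nonneg ?_ fun z => ?_
  · rw [IsHermitian, conjTranspose_eq_transpose_of_trivial]
    exact hVs.neg
  · have := hkB z
    rw [hk1, zero_mul] at this
    rw [star_trivial, neg_mulVec, dotProduct_neg, neg_nonneg]
    exact nonpos_of_mul_nonpos_right this hw

/-- If `z` is in the kernel of `A₁` and `zᵀ A₂ z > 0`, then the multiple of `z zᵀ` normalized by
`A₂ • Y = c₂` is dual feasible; that its value is at least `w` is the required inequality. -/
theorem gapTriple (P : SDP 2 n) (hsymm : P.IsSymm) (hB : P.B.PosSemidef) {w : ℝ} (hw : 0 < w)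
    (hdu : ∀ Y ∈ P.dualFeasible, w ≤ (P.B * Y).trace)
    (hA : (P.A 0).PosSemidef) (hc0 : P.c 0 = 0) (hc1 : 0 < P.c 1)
    (hker : ∀ z, P.B *ᵥ z = 0 → P.A 0 *ᵥ z = 0) :
    GapTriple (P.c 1) w P.B (P.A 0) (P.A 1) := by
  refine ⟨hB, hA, hsymm.1 1, hker, fun z hz => ?_⟩
  have hq : 0 ≤ z ⬝ᵥ P.B *ᵥ z := by simpa using hB.dotProduct_mulVec_nonneg z
  rcases le_or_gt (z ⬝ᵥ P.A 1 *ᵥ z) 0 with hv | hv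
  · exact (mul_nonpos_of_nonneg_of_nonpos hw.le hv).trans (mul_nonneg hc1.le hq)
  · set v := z ⬝ᵥ P.A 1 *ᵥ z with hvdef
    have h := hdu ((P.c 1 / v) • vecMulVec z z)
      ⟨(by simpa using posSemidef_vecMulVec_self_star z :
        (vecMulVec z z).PosSemidef).smul (div_pos hc1 hv).le, fun i => by
        rw [Matrix.mul_smul, trace_smul, trace_mul_vecMulVec_self]
        fin_cases i
        · simp [hz, hc0]
        · simp [← hvdef, hv.ne']⟩
    rw [Matrix.mul_smul, trace_smul, trace_mul_vecMulVec_self, smul_eq_mul,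
      div_mul_eq_mul_div, le_div_iff₀ hv] at h
    exact h

theorem exists_isReformulation_c_pos (P : SDP 2 n) (hc : P.c 1 ≠ 0) :
    ∃ Q : SDP 2 n, P.IsReformulation Q ∧ Q.A 0 = P.A 0 ∧ Q.c 0 = P.c 0 ∧ Q.B = P.B ∧
      0 < Q.c 1 := by
  rcases lt_or_gt_of_ne hc with h | h
  · exact ⟨_, .single (.combine P 1 0 (by decide) (-1) 0 (by norm_num)), by simp, by simp, rfl,
      by simpa using h⟩
  · exact ⟨P, .refl, rfl, rfl, rfl, h⟩

theorem exists_standardForm_of_hasGap (P : SDP 2 n) (hsymm : P.IsSymm)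
    (hfeas : P.primalFeasible.Nonempty) (hgap : P.HasGap) :
    ∃ Q : SDP 2 n, P.IsReformulation Q ∧ Q.IsStandardForm := by
  obtain ⟨P₁, hr₁, hB₁, hmax⟩ := P.exists_maximal_slack hfeas
  have hs₁ := hr₁.isSymm hsymm
  obtain ⟨u₁, w₁, huw₁, hpr₁, hdu₁⟩ := hr₁.hasGap hgap
  obtain ⟨x, hx, hcx, hV⟩ := P₁.exists_posSemidef_combination hs₁ hB₁ huw₁ hpr₁ hdu₁
  have hker : ∀ z, P₁.B *ᵥ z = 0 → (∑ i, x i • P₁.A i) *ᵥ z = 0 := by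
    have hneg : P₁.B - ∑ i, (-x) i • P₁.A i = P₁.B + ∑ i, x i • P₁.A i := by
      simp only [Pi.neg_apply, neg_smul, Finset.sum_neg_distrib, sub_neg_eq_add]
    refine ker_le_of_rank_le hB₁ hV (hneg ▸ hmax (-x) ?_)
    rw [primalFeasible, Set.mem_ofPred_eq, hneg]
    exact hB₁.add hV
  obtain ⟨P₂, hr₂, hA₂, hc₂, hB₂⟩ := P₁.isReformulation_smul_combination hx
  rw [hcx] at hc₂
  rw [← hA₂] at hV hker
  rw [← hB₂] at hB₁ hker
  have hne : P₂.c 1 ≠ 0 := by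
    -- If `c = 0`, then `0` is dual feasible with value `0`, and there is no gap.
    intro h
    obtain ⟨u, w, huw, hpr, hdu⟩ := (hr₁.trans hr₂).hasGap hgap
    have h1 := hpr 0 (by simpa [primalFeasible] using hB₁)
    have h2 := hdu 0 ⟨.zero, fun i => by fin_cases i <;> simp [h, hc₂]⟩
    simp at h1 h2
    linarith
  obtain ⟨P₃, hr₃, hA₃, hc₃, hB₃, hpos⟩ := P₂.exists_isReformulation_c_pos hne
  rw [← hA₃] at hV hker
  rw [← hB₃] at hB₁ hker
  rw [hc₂] at hc₃
  have hr := (hr₁.trans hr₂).trans hr₃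
  obtain ⟨u, w, huw, hpr, hdu⟩ := hr.hasGap hgap
  have hu : 0 ≤ u := by simpa using hpr 0 (by simpa [primalFeasible] using hB₁)
  have hw := hu.trans_lt huw
  have g := P₃.gapTriple (hr.isSymm hsymm) hB₁ hw hdu hV hc₃ hpos hker
  obtain ⟨r, m, V₁, N₁, c₁⟩ := g.exists_slack_eq_one
  obtain ⟨p, q, l, N₂, hl, c₂⟩ := (g.congr c₁).exists_diagonal
  obtain ⟨s, t, N₃, N₄, c₃⟩ := (g.congr (c₁.trans c₂)).exists_corner_eq_neg_one hw
  obtain ⟨d, M, X, Y, Z, hX, c₄⟩ :=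
    (g.congr ((c₁.trans c₂).trans c₃)).exists_standardForm hw
  have hc := ((c₁.trans c₂).trans c₃).trans c₄
  have gf := g.congr hc
  obtain ⟨T, T', h1, h2, e1, e2, e3⟩ := hc
  have hcard : (p + q) + (s + t) = n := by
    simpa using (square_of_invertible T T' h1 h2).symm
  refine ⟨_, hr.trans (P₃.isReformulation_rotate (blockEquiv hcard) h1 h2), p, q, s, t, hcard, l,
    d, M, X, Y, Z, hl, ?_, hX, hc₃, hpos, by rw [← e2], by rw [← e3], by rw [← e1]⟩
  -- If `M = 0`, there is a feasible point whose value lies strictly between `u` and `w`.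
  rintro rfl
  obtain ⟨w', huw', hw'⟩ := exists_between huw
  obtain ⟨a, ha⟩ := gf.exists_posSemidef_of_eq_zero hw hl
    (div_pos (hu.trans_lt huw') hpos) (by rwa [div_mul_cancel₀ _ hpos.ne'])
  rw [← e1, ← e2, ← e3] at ha
  have hfe : ![-a, w' / P₃.c 1] ∈ P₃.primalFeasible := by
    rw [primalFeasible, Set.mem_ofPred_eq, ← posSemidef_congruence_iff h1]
    convert ha using 1
    simp only [Fin.sum_univ_two, Matrix.mul_sub, Matrix.sub_mul, Matrix.mul_add, Matrix.add_mul]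
    simp
    abel
  have := hpr _ hfe
  simp [hc₃, mul_div_cancel₀ _ hpos.ne'] at this
  linarith

end SDP

/-! ### The standard form has a gap -/

namespace SDP

variable {n : ℕ}

/-- In the standard form `M ≠ 0` forces `x₂ = 0`, so that the primal value is `0`. On the dual side
`Λ • Y₁₁ = 0` annihilates the first `p` rows of `Y`, and `A₂ • Y = c₂` then bounds the trace of the
block of `Y` next to them from below. -/
theorem IsStandardForm.hasGap {Q : SDP 2 n} (hQ : Q.IsStandardForm) : Q.HasGap := by
  obtain ⟨p, q, s, t, h, l, d, M, X, Y, Z, hl, hM, -, hc0, hc1, hA0, hA1, hB⟩ := hQ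
  have htr : ∀ (S : Matrix ((Fin p ⊕ Fin q) ⊕ (Fin s ⊕ Fin t))
      ((Fin p ⊕ Fin q) ⊕ (Fin s ⊕ Fin t)) ℝ) (W : Matrix (Fin n) (Fin n) ℝ),
      (reindex (blockEquiv h) (blockEquiv h) S * W).trace =
        ∑ i, ∑ j, S i j * W.submatrix (blockEquiv h) (blockEquiv h) j i := by
    intro S W
    simp only [trace, diag_apply, mul_apply]
    refine (Fintype.sum_equiv (blockEquiv h) _ _ fun i => ?_).symm
    exact Fintype.sum_equiv (blockEquiv h) _ _ fun j => by simp
  -- Any positive upper bound for all `dᵢ` serves as the denominator of the lower bound on the dual.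
  have hDpos : 0 < 1 + ∑ i, |d i| := by positivity
  refine ⟨0, Q.c 1 / (1 + ∑ i, |d i|), div_pos hc1 hDpos, fun x hx => ?_, fun W hW => ?_⟩
  · obtain ⟨i, j, hij⟩ : ∃ i j, M i j ≠ 0 := by
      by_contra! hcon
      exact hM (by ext i j; exact hcon i j)
    have hS := PosSemidef.submatrix (show (Q.B - ∑ i, x i • Q.A i).PosSemidef from hx)
      (blockEquiv h)
    have := hS.apply_eq_zero_of_diag_eq_zero (i := Sum.inr (Sum.inr j))
      (by simp [hA0, hA1, hB]) (Sum.inl (Sum.inl i))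
    simp [hA0, hA1, hB, hij] at this
    simp [hc0, this]
  · obtain ⟨hpsd, htrA⟩ := hW
    have h0 := htrA 0
    have h1 := htrA 1
    rw [hA0, hc0, htr] at h0
    rw [hA1, htr] at h1
    rw [hB, htr]
    have hU := hpsd.submatrix (blockEquiv h)
    generalize W.submatrix (blockEquiv h) (blockEquiv h) = U at h0 h1 hU ⊢
    have hdiag : ∀ i, U (Sum.inl (Sum.inl i)) (Sum.inl (Sum.inl i)) = 0 := by
      have hsum : ∑ i, l i * U (Sum.inl (Sum.inl i)) (Sum.inl (Sum.inl i)) = 0 := by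
        simpa [Fintype.sum_sum_type, diagonal_apply] using h0
      rw [Finset.sum_eq_zero_iff_of_nonneg
        fun i _ => mul_nonneg (hl i).le hU.diag_nonneg] at hsum
      exact fun i => (mul_eq_zero.1 (hsum i (Finset.mem_univ i))).resolve_left (hl i).ne'
    have hcol : ∀ i k, U k (Sum.inl (Sum.inl i)) = 0 := fun i k =>
      hU.apply_eq_zero_of_diag_eq_zero (hdiag i) k
    have hrow : ∀ i k, U (Sum.inl (Sum.inl i)) k = 0 := fun i k => by
      simpa [hcol] using (hU.1.apply (Sum.inl (Sum.inl i)) k).symm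
    simp [Fintype.sum_sum_type, diagonal_apply, one_apply, hcol, hrow] at h1 ⊢
    rw [div_le_iff₀ hDpos, ← h1, Finset.sum_mul]
    have hs : 0 ≤ ∑ i : Fin s, U (Sum.inr (Sum.inl i)) (Sum.inr (Sum.inl i)) :=
      Finset.sum_nonneg fun i _ => hU.diag_nonneg
    have hq : ∑ i, d i * U (Sum.inl (Sum.inr i)) (Sum.inl (Sum.inr i)) ≤
        ∑ i, U (Sum.inl (Sum.inr i)) (Sum.inl (Sum.inr i)) * (1 + ∑ i, |d i|) := by
      refine Finset.sum_le_sum fun i _ => ?_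
      have h2 : |d i| ≤ ∑ i, |d i| :=
        Finset.single_le_sum (f := fun i => |d i|) (fun _ _ => abs_nonneg _) (Finset.mem_univ i)
      have h3 : 0 ≤ U (Sum.inl (Sum.inr i)) (Sum.inl (Sum.inr i)) := hU.diag_nonneg
      rw [mul_comm]
      exact mul_le_mul_of_nonneg_left (by linarith [le_abs_self (d i)]) h3
    linarith

end SDP

theorem theorem1 {n : ℕ} (P : SDP 2 n) (hsymm : P.IsSymm) (hfeas : P.primalFeasible.Nonempty) :
    P.primalVal < P.dualVal ↔ ∃ Q : SDP 2 n, P.IsReformulation Q ∧ Q.IsStandardForm := by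
  rw [SDP.primalVal_lt_dualVal_iff]
  exact ⟨P.exists_standardForm_of_hasGap hsymm hfeas,
    fun ⟨_, hr, hQ⟩ => hr.symm.hasGap hQ.hasGap⟩
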